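/- Let $\{V(s):s\in\mathcal S\}$, $\mathcal S\subset\mathbb R^2$, be a real-valued stochastic process with exponential-tailed margins, $\mathbb P(V(s)>v)\sim e^{-v}$ as $v\to\infty$ for every $s\in\mathcal S$. Let $\lambda\in(0,1)$, let $Q\sim\mathrm{Exp}(1)$ be independent of $V$, and let \[ X(s)=V(s)+\lambda Q+\log(1-\lambda),\qquad s\in\mathcal S, \] be the Huser–Wadsworth mixture. Let $a_h:\mathbb R\to\mathbb R$ and $b_h:\mathbb R\to(0,\infty)$ be functions indexed by spatial lags $h\in\mathbb R^2$. Fix $s_0\in\mathcal S$, $d\in\mathbb N$ and sites $s_1,\dots,s_d\in\mathcal S$, and write $a_i=a_{s_i-s_0}$, $b_i=b_{s_i-s_0}$. Suppose that, for $i=1,\dots,d$, the functions $a_i,b_i$ are twice differentiable on a neighbourhood of $+\infty$ and that, as $v\to\infty$, $a_i'(v)\to\alpha_i\in\mathbb R$, $a_i''(v)\to0$ and $b_i'(v)/b_i(v)\to0$. Suppose that there is a function $G:\mathbb R^d\to\mathbb R$ such that, for every $z\in\mathbb R^d$, \[ F_v(z):=\mathbb P\left(\frac{V(s_i)-a_i(V(s_0))}{b_i(V(s_0))}\le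 z_i,\ i=1,\dots,d\ \Big|\ V(s_0)=v\right)\to G(z),\qquad v\to\infty, \] that all first and second order partial derivatives of $G$ exist on $\mathbb R^d$, and that for each $z$ those of $F_v$ exist at $z$ for large $v$ and converge to those of $G$ at $z$ as $v\to\infty$. Suppose finally that one of the following holds: (i) $b_i(x)\to\infty$ as $x\to\infty$ for all $i=1,\dots,d$; (ii) $a_i(x)\sim x$ and $b_i(x)\sim1$ as $x\to\infty$ for all $i=1,\dots,d$ (the normalisation that arises under asymptotic dependence of $V$). Then $X$ has the same normalisation and the same conditional limit distribution as $V$: for every $z\in\mathbb R^d$, \[ \mathbb P\left(\frac{X(s_i)-a_i(X(s_0))}{b_i(X(s_0))}\le z_i,\ i=1,\dots,d\ \Big|\ X(s_0)=x\right)\to G(z),\qquad x\to\infty. \] Here conditional probabilities given $V(s_0)=v$ or $X(s_0)=x$ are taken from regular conditional distributions, which are determined up to null sets of the law of the conditioning variable; accordingly, statements for large $v$ and limits as $v\to\infty$ or $x\to\infty$ are understood outside such a null set. -/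

import Mathlib

open MeasureTheory ProbabilityTheory Filter Topology Asymptotics

noncomputable section

namespace HWMixture

/-- Spatial locations and lags: the Euclidean plane. -/
abbrev Plane : Type := EuclideanSpace ℝ (Fin 2)

/-- The Huser–Wadsworth mixture on exponential-tailed margins,
`X(s) = V(s) + lam * Q + log (1 - lam)`. -/
def mixture {Ω : Type*} {S : Set Plane} (V : S → Ω → ℝ) (Q : Ω → ℝ) (lam : ℝ) :
    S → Ω → ℝ :=
  fun s ω => V s ω + lam * Q ω + Real.log (1 - lam)

/-- `x → ∞` outside a `μ`-null set. A regular conditional distribution given `Y₀ = x` is determined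
only up to a null set of the law of `Y₀`; limits along this filter do not depend on the version. -/
def essAtTop (μ : Measure ℝ) : Filter ℝ := atTop ⊓ ae μ

/-- The conditional distribution function of the normalised vector,
`P((Y_i - a_i(Y₀)) / b_i(Y₀) ≤ z_i for all i | Y₀ = v)`, in terms of the regular conditional
distribution of `Y` given `Y₀` (on `Y₀ = v` the normalisation is by `a_i(v)` and `b_i(v)`). -/
def normCondDF {Ω : Type*} [MeasurableSpace Ω] (P : Measure Ω) [IsProbabilityMeasure P] {d : ℕ}
    (Y : Fin d → Ω → ℝ) (Y₀ : Ω → ℝ) (a b : Fin d → ℝ → ℝ) (v : ℝ) (z : Fin d → ℝ) : ℝ :=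
  (condDistrib (fun ω i => Y i ω) Y₀ P v).real {y | ∀ i, (y i - a i v) / b i v ≤ z i}

/-- Existence of the partial derivative `∂f/∂z_k` at `z`. -/
def HasPartial {d : ℕ} (k : Fin d) (f : (Fin d → ℝ) → ℝ) (z : Fin d → ℝ) : Prop :=
  LineDifferentiableAt ℝ f z (Pi.single k 1)

/-- The partial derivative `∂f/∂z_k` at `z`. -/
def partialD {d : ℕ} (k : Fin d) (f : (Fin d → ℝ) → ℝ) (z : Fin d → ℝ) : ℝ :=
  lineDeriv ℝ f z (Pi.single k 1)

/-- All first and second order partial derivatives of `F v` exist (at each point, for `v` far enough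
along `L`), those of `G` exist, and the former converge pointwise to the latter along `L`. -/
structure PartialsConverge {d : ℕ} (L : Filter ℝ) (F : ℝ → (Fin d → ℝ) → ℝ)
    (G : (Fin d → ℝ) → ℝ) : Prop where
  limit_first : ∀ z k, HasPartial k G z
  limit_second : ∀ z k l, HasPartial k (partialD l G) z
  first : ∀ z k, ∀ᶠ v in L, HasPartial k (F v) z
  second : ∀ z k l, ∀ᶠ v in L, HasPartial k (partialD l (F v)) z
  tendsto_first : ∀ z k, Tendsto (fun v => partialD k (F v) z) L (𝓝 (partialD k G z))
  tendsto_second : ∀ z k l,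
    Tendsto (fun v => partialD k (partialD l (F v)) z) L (𝓝 (partialD k (partialD l G) z))

/-- Conditions on a pair of normalising functions: `b > 0`, both are twice differentiable (near
infinity), and `a' → α`, `a'' = o(1)`, `b' / b = o(1)` at infinity. -/
structure RegularNormalisation (a b : ℝ → ℝ) (α : ℝ) : Prop where
  b_pos : ∀ v, 0 < b v
  a_diff : ∀ᶠ v in atTop, DifferentiableAt ℝ a v
  a_diff_two : ∀ᶠ v in atTop, DifferentiableAt ℝ (deriv a) v
  b_diff : ∀ᶠ v in atTop, DifferentiableAt ℝ b v
  b_diff_two : ∀ᶠ v in atTop, DifferentiableAt ℝ (deriv b) v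
  a_deriv : Tendsto (deriv a) atTop (𝓝 α)
  a_deriv_two : Tendsto (deriv (deriv a)) atTop (𝓝 0)
  b_deriv : Tendsto (fun v => deriv b v / b v) atTop (𝓝 0)

end HWMixture

end

noncomputable section

namespace HWMixture

open scoped ENNReal

/-! Write `E = lam * Q + c`, so that `X = V + E` at every site. By Bayes' formula
(`condDistrib_add_indep`), the law of the `X(s_i)` given `X(s₀) = x` averages the laws of the
`V(s_i) + x - v` given `V(s₀) = v` over a posterior for `v`. This posterior has density proportional
to `exp (v / lam)` on `v ≤ x - c` with respect to the law of `V(s₀)`. Since `1 / lam > 1` beats the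
tail `exp (-v)`, the posterior sits within a bounded distance of `x`, up to `ε`
(`exists_posterior_tail_le`).

On such a window `x - T ≤ v ≤ x - c`, rewriting the event for `X` in the normalisation at `v` moves
each threshold `z_i` by a uniformly vanishing amount (`eventually_abs_threshold_sub_le`). In case
(i) the growing scale absorbs bounded location errors. In case (ii) the slope `α` must be 1, so the
location errors vanish themselves.

The conditional probability therefore lies, up to small errors, between values of `F_v` at `z - δ`
and `z + δ`. Convergence at these two points suffices, and `G` has small increments along the
diagonal because it is monotone and separately continuous (`exists_shift_diag_sub_le`). -/

/-- Adding the same real number to all coordinates. -/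
def shift {ι : Type*} (t : ℝ) (y : ι → ℝ) : ι → ℝ := fun i => y i + t

lemma measurable_shift_uncurry {ι : Type*} :
    Measurable (fun p : ℝ × (ι → ℝ) => shift p.1 p.2) := by
  unfold shift
  fun_prop

lemma measurable_shift {ι : Type*} (t : ℝ) : Measurable (shift t : (ι → ℝ) → ι → ℝ) :=
  measurable_shift_uncurry.comp (measurable_const.prodMk measurable_id)

/-! ### Bayes' formula for an independent shift -/

section Bayes

variable {Ω : Type*} [MeasurableSpace Ω] {P : Measure Ω} [IsProbabilityMeasure P] {ι : Type*}
  {Y : Ω → ι → ℝ} {Y₀ E : Ω → ℝ} {f : ℝ → ℝ≥0∞}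

/-- The (unnormalised) density of `Y₀ + E`, where `E` has density `f` and `Y₀` has law `μ`. -/
def convDensity (μ : Measure ℝ) (f : ℝ → ℝ≥0∞) (x : ℝ) : ℝ≥0∞ := ∫⁻ v, f (x - v) ∂μ

lemma measurable_convDensity (μ : Measure ℝ) [SFinite μ] (hf : Measurable f) :
    Measurable (convDensity μ f) :=
  Measurable.lintegral_prod_right' (f := fun p : ℝ × ℝ => f (p.1 - p.2)) (by fun_prop)

/-- Joint expectation of functions of `(Y₀ + E, Y + E)` for an independent shift `E`. -/
lemma lintegral_add_indep [Finite ι] (hY : Measurable Y) (hY₀ : Measurable Y₀) (hE : Measurable E)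
    (hf : Measurable f) (hEf : P.map E = volume.withDensity f)
    (hind : IndepFun E (fun ω => (Y₀ ω, Y ω)) P) {h : ℝ × (ι → ℝ) → ℝ≥0∞} (hh : Measurable h) :
    ∫⁻ ω, h (Y₀ ω + E ω, shift (E ω) (Y ω)) ∂P =
      ∫⁻ x, ∫⁻ v, f (x - v) * ∫⁻ y, h (x, shift (x - v) y) ∂(condDistrib Y Y₀ P v)
        ∂(P.map Y₀) := by
  have hjoint := (indepFun_iff_map_prod_eq_prod_map_map hE.aemeasurable
    (hY₀.prodMk hY).aemeasurable).1 hind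
  rw [← compProd_map_condDistrib hY.aemeasurable] at hjoint
  have : IsProbabilityMeasure (P.map Y₀) := Measure.isProbabilityMeasure_map hY₀.aemeasurable
  have : IsProbabilityMeasure (P.map E) := Measure.isProbabilityMeasure_map hE.aemeasurable
  have hg : Measurable (fun p : ℝ × ℝ × (ι → ℝ) => h (p.2.1 + p.1, shift p.1 p.2.2)) :=
    hh.comp ((by fun_prop : Measurable fun p : ℝ × ℝ × (ι → ℝ) => p.2.1 + p.1).prodMk
      (measurable_shift_uncurry.comp (by fun_prop : Measurable fun p : ℝ × ℝ × (ι → ℝ) =>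
        (p.1, p.2.2))))
  have hk : Measurable (fun p : ℝ × ℝ =>
      ∫⁻ y, h (p.2 + p.1, shift p.1 y) ∂(condDistrib Y Y₀ P p.2)) := by
    have := Measurable.lintegral_kernel_prod_right
      (κ := (condDistrib Y Y₀ P).comap (Prod.snd : ℝ × ℝ → ℝ) measurable_snd)
      (f := fun p y => h (p.2 + p.1, shift p.1 y)) (hg.comp
        (by fun_prop : Measurable fun q : (ℝ × ℝ) × (ι → ℝ) => (q.1.1, q.1.2, q.2)))
    simpa using this
  calc ∫⁻ ω, h (Y₀ ω + E ω, shift (E ω) (Y ω)) ∂P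
      = ∫⁻ p, h (p.2.1 + p.1, shift p.1 p.2.2) ∂(P.map fun ω => (E ω, Y₀ ω, Y ω)) := by
        rw [lintegral_map hg (hE.prodMk (hY₀.prodMk hY))]
    _ = ∫⁻ e, ∫⁻ v, ∫⁻ y, h (v + e, shift e y) ∂(condDistrib Y Y₀ P v) ∂(P.map Y₀)
          ∂(P.map E) := by
        rw [hjoint, lintegral_prod _ hg.aemeasurable]
        refine lintegral_congr fun e => ?_
        rw [Measure.lintegral_compProd]
        exact hg.comp measurable_prodMk_left
    _ = ∫⁻ v, ∫⁻ e, ∫⁻ y, h (v + e, shift e y) ∂(condDistrib Y Y₀ P v) ∂(P.map E)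
          ∂(P.map Y₀) := lintegral_lintegral_swap hk.aemeasurable
    _ = ∫⁻ v, ∫⁻ x, f (x - v) * ∫⁻ y, h (x, shift (x - v) y) ∂(condDistrib Y Y₀ P v)
          ∂volume ∂(P.map Y₀) := by
        refine lintegral_congr fun v => ?_
        have hkv : Measurable fun e => ∫⁻ y, h (v + e, shift e y) ∂(condDistrib Y Y₀ P v) :=
          hk.comp (measurable_prodMk_right (y := v))
        -- Translation invariance of Lebesgue measure allows the substitution `e = x - v`.
        rw [hEf, lintegral_withDensity_eq_lintegral_mul _ hf hkv,
          ← lintegral_sub_right_eq_self _ v]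
        simp
    _ = _ := by
        refine lintegral_lintegral_swap (Measurable.aemeasurable ?_)
        refine Measurable.mul (by fun_prop) ?_
        have := hk.comp (by fun_prop : Measurable fun p : ℝ × ℝ => (p.2 - p.1, p.1))
        simpa [Function.comp_def] using this

/-- With a test function of the first coordinate only, the inner kernel integral in
`lintegral_add_indep` has total mass one and disappears. -/
lemma map_add_indep [Finite ι] (hY : Measurable Y) (hY₀ : Measurable Y₀) (hE : Measurable E)
    (hf : Measurable f) (hEf : P.map E = volume.withDensity f)
    (hind : IndepFun E (fun ω => (Y₀ ω, Y ω)) P) :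
    P.map (fun ω => Y₀ ω + E ω) = volume.withDensity (convDensity (P.map Y₀) f) := by
  have hX₀ : Measurable fun ω => Y₀ ω + E ω := hY₀.add hE
  ext s hs
  rw [withDensity_apply _ hs, ← lintegral_indicator_one hs,
    lintegral_map (measurable_one.indicator hs) hX₀,
    lintegral_add_indep hY hY₀ hE hf hEf hind
      (h := fun p => s.indicator 1 p.1) ((measurable_one.indicator hs).comp measurable_fst),
    ← lintegral_indicator hs]
  refine lintegral_congr fun x => ?_
  by_cases hx : x ∈ s <;> simp [hx, convDensity]

/-- The posterior law of `Y₀` given `Y₀ + E = x`, as a kernel. -/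
def posteriorKernel (μ : Measure ℝ) [SFinite μ] (f : ℝ → ℝ≥0∞) : Kernel ℝ ℝ :=
  (Kernel.const ℝ μ).withDensity fun x v => f (x - v) / convDensity μ f x

lemma measurable_posterior_density (μ : Measure ℝ) [SFinite μ] (hf : Measurable f) :
    Measurable (Function.uncurry fun x v => f (x - v) / convDensity μ f x) :=
  Measurable.div (f := fun p : ℝ × ℝ => f (p.1 - p.2)) (by fun_prop)
    ((measurable_convDensity μ hf).comp measurable_fst)

/-- The total mass is `J / J` with `J` the normaliser, which is at most one in `ℝ≥0∞` even when `J`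
is `0` or `∞`; no `x` has to be excluded. -/
lemma isFiniteKernel_posteriorKernel (μ : Measure ℝ) [IsFiniteMeasure μ] (hf : Measurable f) :
    IsFiniteKernel (posteriorKernel μ f) := by
  refine ⟨1, ENNReal.one_lt_top, fun x => ?_⟩
  rw [posteriorKernel, Kernel.withDensity_apply _ (measurable_posterior_density μ hf),
    withDensity_apply _ MeasurableSet.univ, Measure.restrict_univ, Kernel.const_apply]
  simp only [div_eq_mul_inv]
  rw [lintegral_mul_const _ (by fun_prop)]
  exact ENNReal.div_self_le_one

/-- The law of `shift (x - v) y` for `y` distributed according to `κ v`, as a kernel in `(x, v)`. -/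
def shiftKernel (κ : Kernel ℝ (ι → ℝ)) : Kernel (ℝ × ℝ) (ι → ℝ) :=
  (Kernel.id ×ₖ κ.comap Prod.snd measurable_snd).map fun p => shift (p.1.1 - p.1.2) p.2

lemma shiftKernel_apply (κ : Kernel ℝ (ι → ℝ)) [IsSFiniteKernel κ] (p : ℝ × ℝ) {B : Set (ι → ℝ)}
    (hB : MeasurableSet B) : shiftKernel κ p B = κ p.2 (shift (p.1 - p.2) ⁻¹' B) := by
  have hm : Measurable fun p : (ℝ × ℝ) × (ι → ℝ) => shift (p.1.1 - p.1.2) p.2 :=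
    measurable_shift_uncurry.comp (by fun_prop : Measurable fun p : (ℝ × ℝ) × (ι → ℝ) =>
        (p.1.1 - p.1.2, p.2))
  rw [shiftKernel, Kernel.map_apply' _ hm _ hB, Kernel.id_prod_apply' _ _ (hm hB)]
  rfl

/-- Bayes' formula for the conditional law of `Y + E` given `Y₀ + E`, for an independent shift `E`
with density `f`. -/
theorem condDistrib_add_indep [Finite ι] (hY : Measurable Y) (hY₀ : Measurable Y₀) (hE : Measurable E)
    (hf : Measurable f) (hEf : P.map E = volume.withDensity f)
    (hind : IndepFun E (fun ω => (Y₀ ω, Y ω)) P) :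
    ∀ᵐ x ∂(P.map fun ω => Y₀ ω + E ω), convDensity (P.map Y₀) f x ≠ 0 ∧
      convDensity (P.map Y₀) f x ≠ ∞ ∧ ∀ B : Set (ι → ℝ), MeasurableSet B →
      condDistrib (fun ω => shift (E ω) (Y ω)) (fun ω => Y₀ ω + E ω) P x B *
        convDensity (P.map Y₀) f x =
        ∫⁻ v, f (x - v) * condDistrib Y Y₀ P v (shift (x - v) ⁻¹' B) ∂(P.map Y₀) := by
  have hμ : IsProbabilityMeasure (P.map Y₀) := Measure.isProbabilityMeasure_map hY₀.aemeasurable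
  set μ := P.map Y₀ with hμdef
  set K := condDistrib Y Y₀ P with hK
  have hJ := measurable_convDensity μ hf
  have hX₀ : Measurable fun ω => Y₀ ω + E ω := hY₀.add hE
  have hX : Measurable fun ω => shift (E ω) (Y ω) := measurable_shift_uncurry.comp (hE.prodMk hY)
  have hmap := map_add_indep hY hY₀ hE hf hEf hind
  -- The density of a probability measure has finite integral, hence is finite almost everywhere.
  have hfin : ∀ᵐ x, convDensity μ f x < ∞ := by
    refine ae_lt_top hJ ?_
    have h1 : (P.map fun ω => Y₀ ω + E ω) Set.univ ≠ ∞ := by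
      have := Measure.isProbabilityMeasure_map (μ := P) hX₀.aemeasurable
      exact measure_ne_top (P.map fun ω => Y₀ ω + E ω) _
    rw [hmap, withDensity_apply _ MeasurableSet.univ, Measure.restrict_univ] at h1
    exact h1
  have hpf := isFiniteKernel_posteriorKernel μ hf
  -- Candidate conditional law: draw `v` from the posterior given `x`, then `y` from `K v`, and
  -- shift by `x - v`.
  let κ : Kernel ℝ (ι → ℝ) := shiftKernel K ∘ₖ (Kernel.id ×ₖ posteriorKernel μ f)
  have hsm : Measurable fun p : (ℝ × ℝ) × (ι → ℝ) => shift (p.1.1 - p.1.2) p.2 :=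
    measurable_shift_uncurry.comp (by fun_prop : Measurable fun p : (ℝ × ℝ) × (ι → ℝ) =>
        (p.1.1 - p.1.2, p.2))
  have hSM : IsMarkovKernel (shiftKernel K) := Kernel.IsMarkovKernel.map _ hsm
  have hκ : ∀ x (B : Set (ι → ℝ)), MeasurableSet B → κ x B =
      ∫⁻ v, f (x - v) / convDensity μ f x * K v (shift (x - v) ⁻¹' B) ∂μ := by
    intro x B hB
    have hm := Kernel.measurable_coe (shiftKernel K) hB
    have hmx : Measurable fun v => shiftKernel K (x, v) B := hm.comp measurable_prodMk_left
    rw [Kernel.comp_apply' _ _ _ hB, Kernel.lintegral_id_prod hm, posteriorKernel,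
      Kernel.lintegral_withDensity _ (measurable_posterior_density μ hf) _ hmx]
    simp [shiftKernel_apply K _ hB]
  have hκmul : ∀ x (B : Set (ι → ℝ)), MeasurableSet B → convDensity μ f x < ∞ →
      κ x B * convDensity μ f x = ∫⁻ v, f (x - v) * K v (shift (x - v) ⁻¹' B) ∂μ := by
    intro x B hB hx
    have hmm : Measurable fun v => K v (shift (x - v) ⁻¹' B) := by
      have hm := (Kernel.measurable_coe (shiftKernel K) hB).comp (measurable_prodMk_left (x := x))
      simpa [Function.comp_def, shiftKernel_apply K _ hB] using hm
    have hfm : Measurable fun v => f (x - v) := by fun_prop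
    rcases eq_or_ne (convDensity μ f x) 0 with h0 | h0
    -- A zero normaliser forces `f (x - v) = 0` for almost every `v`, so both sides vanish.
    · rw [h0, mul_zero]
      symm
      have := (lintegral_eq_zero_iff hfm).1 h0
      refine (lintegral_eq_zero_iff (hfm.mul hmm)).2 ?_
      filter_upwards [this] with v hv
      simp_all
    · have hint : Measurable fun v =>
          f (x - v) / convDensity μ f x * K v (shift (x - v) ⁻¹' B) := (hfm.div_const _).mul hmm
      rw [hκ x B hB, ← lintegral_mul_const _ hint]
      refine lintegral_congr fun v => ?_
      rw [mul_right_comm, ENNReal.div_mul_cancel h0 hx.ne]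
  have hcomp : P.map (fun ω => (Y₀ ω + E ω, shift (E ω) (Y ω))) =
      P.map (fun ω => Y₀ ω + E ω) ⊗ₘ κ := by
    ext s hs
    rw [Measure.compProd_apply hs, ← lintegral_indicator_one hs,
      lintegral_map (measurable_one.indicator hs) (hX₀.prodMk hX),
      lintegral_add_indep hY hY₀ hE hf hEf hind (measurable_one.indicator hs), hmap,
      lintegral_withDensity_eq_lintegral_mul _ hJ (Kernel.measurable_kernel_prodMk_left hs)]
    refine lintegral_congr_ae ?_
    filter_upwards [hfin] with x hx
    have hsx : MeasurableSet (Prod.mk x ⁻¹' s) := measurable_prodMk_left hs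
    rw [Pi.mul_apply, mul_comm, hκmul x _ hsx hx]
    refine lintegral_congr fun v => ?_
    congr 1
    rw [← lintegral_indicator_one (measurable_shift _ hsx)]
    rfl
  -- Disintegrations are almost everywhere unique, which identifies the candidate with the
  -- conditional law.
  have hcond := condDistrib_ae_eq_of_measure_eq_compProd (fun ω => Y₀ ω + E ω)
    hX.aemeasurable hcomp
  have hne : ∀ᵐ x ∂(P.map fun ω => Y₀ ω + E ω), convDensity μ f x ≠ 0 := by
    rw [hmap, ae_withDensity_iff hJ]
    exact ae_of_all _ fun x hx => hx
  have hfin' : ∀ᵐ x ∂(P.map fun ω => Y₀ ω + E ω), convDensity μ f x < ∞ := by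
    rw [hmap]
    exact (withDensity_absolutelyContinuous _ _).ae_le hfin
  filter_upwards [hcond, hne, hfin'] with x hx h0 h1
  refine ⟨h0, h1.ne, fun B hB => ?_⟩
  rw [hx, hκmul x B hB h1]

end Bayes

/-! ### The density of the shift -/

/-- The density of `lam * Q + c` for a standard exponential variable `Q`. -/
def affineExpPDF (lam c e : ℝ) : ℝ≥0∞ :=
  ENNReal.ofReal lam⁻¹ * exponentialPDF 1 ((e - c) / lam)

lemma measurable_affineExpPDF (lam c : ℝ) : Measurable (affineExpPDF lam c) := by
  have h : Measurable (exponentialPDF 1) := (measurable_exponentialPDFReal 1).ennreal_ofReal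
  unfold affineExpPDF
  fun_prop

lemma affineExpPDF_of_lt {lam c e : ℝ} (hlam : 0 < lam) (h : e < c) : affineExpPDF lam c e = 0 := by
  rw [affineExpPDF, exponentialPDF_of_neg (div_neg_of_neg_of_pos (sub_neg.2 h) hlam), mul_zero]

/-- Separates the dependence on `x` from that on `v`: the factor in `x` cancels when posterior
masses are compared. -/
lemma affineExpPDF_sub_of_le {lam c x v : ℝ} (hlam : 0 < lam) (h : v ≤ x - c) :
    affineExpPDF lam c (x - v) = ENNReal.ofReal (lam⁻¹ * Real.exp ((c - x) / lam)) *
      ENNReal.ofReal (Real.exp (lam⁻¹ * v)) := by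
  rw [affineExpPDF, exponentialPDF_of_nonneg (div_nonneg (by linarith) hlam.le),
    ← ENNReal.ofReal_mul (by positivity), ← ENNReal.ofReal_mul (by positivity), mul_assoc,
    ← Real.exp_add]
  congr 3
  rw [one_mul, one_mul]
  congr 1
  field_simp
  ring

lemma affineExpPDF_sub_le {lam : ℝ} (hlam : 0 < lam) (c x v : ℝ) :
    affineExpPDF lam c (x - v) ≤ ENNReal.ofReal (lam⁻¹ * Real.exp ((c - x) / lam)) *
      ENNReal.ofReal (Real.exp (lam⁻¹ * v)) := by
  rcases le_or_gt v (x - c) with h | h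
  · exact (affineExpPDF_sub_of_le hlam h).le
  · rw [affineExpPDF_of_lt hlam (by linarith)]
    exact zero_le

lemma map_affine_expMeasure {lam : ℝ} (hlam : 0 < lam) (c : ℝ) :
    (expMeasure 1).map (fun q => lam * q + c) = volume.withDensity (affineExpPDF lam c) := by
  have hm : Measurable (exponentialPDF 1) := (measurable_exponentialPDFReal 1).ennreal_ofReal
  have hf := measurable_affineExpPDF lam c
  have ha : Measurable fun q : ℝ => lam * q + c := by fun_prop
  ext s hs
  have h1 : Measurable fun q : ℝ => s.indicator (1 : ℝ → ℝ≥0∞) (lam * q + c) :=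
    (measurable_one.indicator hs).comp ha
  have h2 : Measurable fun e : ℝ => s.indicator (affineExpPDF lam c) (e + c) :=
    (hf.indicator hs).comp (by fun_prop)
  have hscale : ∀ g : ℝ → ℝ≥0∞, Measurable g →
      ∫⁻ e, g e = ∫⁻ q, ENNReal.ofReal |lam| * g (lam * q) := by
    intro g hg
    conv_lhs => rw [← Real.smul_map_volume_mul_left hlam.ne']
    rw [lintegral_smul_measure, lintegral_map hg (by fun_prop), smul_eq_mul,
      lintegral_const_mul _ (show Measurable fun q => g (lam * q) from hg.comp (by fun_prop))]
  rw [withDensity_apply _ hs, ← lintegral_indicator hs, ← lintegral_indicator_one hs,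
    lintegral_map (measurable_one.indicator hs) ha,
    ← lintegral_add_right_eq_self (s.indicator (affineExpPDF lam c)) c, hscale _ h2,
    show expMeasure 1 = volume.withDensity (exponentialPDF 1) from rfl,
    lintegral_withDensity_eq_lintegral_mul _ hm h1]
  refine lintegral_congr fun q => ?_
  by_cases hq : lam * q + c ∈ s
  · simp only [Pi.mul_apply, Set.indicator_of_mem hq, Pi.one_apply, mul_one, affineExpPDF,
      add_sub_cancel_right, mul_div_cancel_left₀ q hlam.ne', ← mul_assoc, abs_of_pos hlam]
    rw [← ENNReal.ofReal_mul hlam.le, mul_inv_cancel₀ hlam.ne', ENNReal.ofReal_one, one_mul]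
  · simp [hq]

/-! ### Exponential tails and tightness of the posterior -/

section Tail

variable {μ : Measure ℝ} [IsProbabilityMeasure μ]

/-- Beyond some `M` this is the asymptotic bound; below `M` a probability is at most `1 ≤ exp (M -
v)`. -/
lemma exists_tail_le (hμ : (fun v : ℝ => μ.real (Set.Ioi v)) ~[atTop] fun v => Real.exp (-v)) :
    ∃ C, 0 < C ∧ ∀ v, μ.real (Set.Ioi v) ≤ C * Real.exp (-v) := by
  obtain ⟨M, hM⟩ := eventually_atTop.1 (hμ.isBigO.bound.choose_spec)
  set K := hμ.isBigO.bound.choose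
  refine ⟨max K (Real.exp M), lt_max_of_lt_right (Real.exp_pos _), fun v => ?_⟩
  rcases le_or_gt M v with h | h
  · have := hM v h
    rw [Real.norm_of_nonneg measureReal_nonneg, Real.norm_of_nonneg (Real.exp_pos _).le] at this
    exact this.trans (by gcongr; exact le_max_left _ _)
  · calc μ.real (Set.Ioi v) ≤ 1 := measureReal_le_one
      _ ≤ Real.exp M * Real.exp (-v) := by
        rw [← Real.exp_add]; exact Real.one_le_exp (by linarith)
      _ ≤ _ := by gcongr; exact le_max_right _ _

lemma lintegral_exp_mul_Iic {β : ℝ} (hβ : 0 < β) {C : ℝ} (hC : 0 ≤ C) (t : ℝ) :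
    ∫⁻ u in Set.Iic t, ENNReal.ofReal (C * Real.exp (β * u)) =
      ENNReal.ofReal (C * (Real.exp (β * t) / β)) := by
  rw [← ofReal_integral_eq_lintegral_ofReal ((integrableOn_exp_mul_Iic hβ t).const_mul C)
    (ae_of_all _ fun u => by positivity), integral_const_mul, integral_exp_mul_Iic hβ]

/-- Write `exp (β v)` as the integral of `β exp (β u)` over `u < v` and exchange integrals. The tail
bound leaves `exp ((β - 1) u)` over `u ≤ t`, integrable at `-∞` because `β > 1`. -/
lemma exists_lintegral_exp_Iio_le
    (hμ : (fun v : ℝ => μ.real (Set.Ioi v)) ~[atTop] fun v => Real.exp (-v)) {β : ℝ}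
    (hβ : 1 < β) :
    ∃ C, 0 < C ∧ ∀ t, ∫⁻ v in Set.Iio t, ENNReal.ofReal (Real.exp (β * v)) ∂μ ≤
      ENNReal.ofReal (C * Real.exp ((β - 1) * t)) := by
  obtain ⟨C, hC, htail⟩ := exists_tail_le hμ
  have hβ0 : 0 < β := by linarith
  have hβ1 : 0 < β - 1 := by linarith
  refine ⟨β * C / (β - 1), by positivity, fun t => ?_⟩
  have hg : Measurable fun u : ℝ => ENNReal.ofReal (β * Real.exp (β * u)) := by fun_prop
  have hexp : ∀ v, ENNReal.ofReal (Real.exp (β * v)) =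
      ∫⁻ u, (Set.Iio v).indicator (fun u => ENNReal.ofReal (β * Real.exp (β * u))) u := by
    intro v
    rw [lintegral_indicator measurableSet_Iio, setLIntegral_congr Iio_ae_eq_Iic,
      lintegral_exp_mul_Iic hβ0 hβ0.le, mul_div_cancel₀ _ hβ0.ne']
  have hind : Measurable (Function.uncurry fun v u : ℝ =>
      (Set.Iio v).indicator (fun u => ENNReal.ofReal (β * Real.exp (β * u))) u) := by
    have : (Function.uncurry fun v u : ℝ =>
      (Set.Iio v).indicator (fun u => ENNReal.ofReal (β * Real.exp (β * u))) u) =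
      {p : ℝ × ℝ | p.2 < p.1}.indicator
        (fun p => ENNReal.ofReal (β * Real.exp (β * p.2))) := by
      ext p
      simp [Set.indicator_apply, Function.uncurry]
    rw [this]
    exact (hg.comp measurable_snd).indicator (measurableSet_lt measurable_snd measurable_fst)
  calc ∫⁻ v in Set.Iio t, ENNReal.ofReal (Real.exp (β * v)) ∂μ
      = ∫⁻ u, ∫⁻ v in Set.Iio t,
          (Set.Iio v).indicator (fun u => ENNReal.ofReal (β * Real.exp (β * u))) u ∂μ := by
        rw [← lintegral_lintegral_swap hind.aemeasurable]
        exact lintegral_congr fun v => hexp v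
    _ ≤ ∫⁻ u, (Set.Iic t).indicator
          (fun u => ENNReal.ofReal (β * C * Real.exp ((β - 1) * u))) u := by
        refine lintegral_mono fun u => ?_
        have hrw : ∀ v, (Set.Iio v).indicator
            (fun u => ENNReal.ofReal (β * Real.exp (β * u))) u =
            (Set.Ioi u).indicator (fun _ => ENNReal.ofReal (β * Real.exp (β * u))) v := by
          intro v
          simp [Set.indicator_apply]
        simp only [hrw]
        rw [lintegral_indicator_const measurableSet_Ioi, Measure.restrict_apply measurableSet_Ioi]
        by_cases hu : u ≤ t
        · rw [Set.indicator_of_mem (Set.mem_Iic.2 hu)]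
          calc ENNReal.ofReal (β * Real.exp (β * u)) * μ (Set.Ioi u ∩ Set.Iio t)
              ≤ ENNReal.ofReal (β * Real.exp (β * u)) * ENNReal.ofReal (C * Real.exp (-u)) := by
                gcongr
                refine (measure_mono Set.inter_subset_left).trans ?_
                rw [← ofReal_measureReal]
                exact ENNReal.ofReal_le_ofReal (htail u)
            _ = _ := by
                rw [← ENNReal.ofReal_mul (by positivity)]
                congr 1
                rw [show (β - 1) * u = β * u + -u by ring, Real.exp_add]
                ring
        · have : Set.Ioi u ∩ Set.Iio t = ∅ := by
            ext v
            simp only [Set.mem_inter_iff, Set.mem_Ioi, Set.mem_Iio, Set.mem_empty_iff_false,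
              iff_false]
            exact fun h => hu (h.1.trans h.2).le
          simp [this]
    _ = _ := by
        rw [lintegral_indicator measurableSet_Iic, lintegral_exp_mul_Iic hβ1 (by positivity)]
        congr 1
        ring

/-- The interval `(y - 1, y]` alone is enough: its mass times `exp y` tends to `e - 1 > 1`, and the
integrand there is at least `exp (β (y - 1))`. -/
lemma eventually_le_lintegral_exp_Iic
    (hμ : (fun v : ℝ => μ.real (Set.Ioi v)) ~[atTop] fun v => Real.exp (-v)) {β : ℝ}
    (hβ : 0 ≤ β) :
    ∀ᶠ y in atTop, ENNReal.ofReal (Real.exp (-β) * Real.exp ((β - 1) * y)) ≤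
      ∫⁻ v in Set.Iic y, ENNReal.ofReal (Real.exp (β * v)) ∂μ := by
  have hlim : Tendsto (fun v => μ.real (Set.Ioi v) * Real.exp v) atTop (𝓝 1) := by
    have := (isEquivalent_iff_tendsto_one
      (Eventually.of_forall fun v : ℝ => (Real.exp_pos (-v)).ne')).1 hμ
    refine this.congr fun v => ?_
    rw [Pi.div_apply, Real.exp_neg, div_inv_eq_mul]
  have hlim' : Tendsto (fun y => μ.real (Set.Ioi (y - 1)) * Real.exp (y - 1) * Real.exp 1 -
      μ.real (Set.Ioi y) * Real.exp y) atTop (𝓝 (1 * Real.exp 1 - 1)) :=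
    ((hlim.comp (tendsto_atTop_add_const_right _ (-1) tendsto_id)).mul_const _).sub hlim
  have h2 : (1 : ℝ) < 1 * Real.exp 1 - 1 := by
    have := Real.exp_one_gt_d9
    linarith
  filter_upwards [hlim'.eventually (lt_mem_nhds h2)] with y hy
  have hy' : Real.exp (-y) ≤ μ.real (Set.Ioc (y - 1) y) := by
    have h3 : μ.real (Set.Ioc (y - 1) y) = μ.real (Set.Ioi (y - 1)) - μ.real (Set.Ioi y) := by
      rw [← Set.Ioi_sdiff_Ioi, measureReal_sdiff (Set.Ioi_subset_Ioi (by linarith))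
        measurableSet_Ioi]
    have h4 : Real.exp (y - 1) * Real.exp 1 = Real.exp y := by rw [← Real.exp_add]; ring_nf
    rw [mul_assoc, h4, ← sub_mul, ← h3] at hy
    rw [Real.exp_neg, inv_le_iff_one_le_mul₀ (Real.exp_pos _)]
    exact hy.le
  calc ENNReal.ofReal (Real.exp (-β) * Real.exp ((β - 1) * y))
      = ENNReal.ofReal (Real.exp (β * (y - 1))) * ENNReal.ofReal (Real.exp (-y)) := by
        rw [← ENNReal.ofReal_mul (by positivity), ← Real.exp_add, ← Real.exp_add]
        ring_nf
    _ ≤ ENNReal.ofReal (Real.exp (β * (y - 1))) * μ (Set.Ioc (y - 1) y) := by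
        gcongr
        rw [← ofReal_measureReal]
        exact ENNReal.ofReal_le_ofReal hy'
    _ = ∫⁻ v in Set.Ioc (y - 1) y, ENNReal.ofReal (Real.exp (β * (y - 1))) ∂μ := by
        rw [setLIntegral_const]
    _ ≤ ∫⁻ v in Set.Ioc (y - 1) y, ENNReal.ofReal (Real.exp (β * v)) ∂μ := by
        refine setLIntegral_mono (by fun_prop) fun v hv => ?_
        gcongr
        exact hv.1.le
    _ ≤ _ := lintegral_mono_set Set.Ioc_subset_Iic_self

/-- Given `Y₀ + E = x`, the shift `E` is tight as `x → ∞`, if `Y₀` has a standard exponential tail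
and `E` is exponential with a lighter tail. -/
theorem exists_posterior_tail_le
    (hμ : (fun v : ℝ => μ.real (Set.Ioi v)) ~[atTop] fun v => Real.exp (-v)) {lam : ℝ}
    (hlam : 0 < lam) (hlam' : lam < 1) (c : ℝ) {ε : ℝ} (hε : 0 < ε) :
    ∃ T, ∀ᶠ x in atTop, ∫⁻ v in Set.Iio (x - T), affineExpPDF lam c (x - v) ∂μ ≤
      ENNReal.ofReal ε * convDensity μ (affineExpPDF lam c) x := by
  have hβ : 1 < lam⁻¹ := (one_lt_inv₀ hlam).2 hlam'
  obtain ⟨C, hC, hup⟩ := exists_lintegral_exp_Iio_le hμ hβ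
  have hβ1 : 0 < lam⁻¹ - 1 := by linarith
  -- The upper and lower bounds both carry `exp ((lam⁻¹ - 1) x)`; this compares the remaining
  -- constants, the lower bound being taken at `y = x - c`.
  have hT : ∃ T, C * Real.exp (-((lam⁻¹ - 1) * T)) ≤
      ε * Real.exp (-lam⁻¹ - (lam⁻¹ - 1) * c) := by
    have h : Tendsto (fun T : ℝ => C * Real.exp (-((lam⁻¹ - 1) * T))) atTop (𝓝 (C * 0)) :=
      (Real.tendsto_exp_neg_atTop_nhds_zero.comp (tendsto_id.const_mul_atTop hβ1)).const_mul C
    rw [mul_zero] at h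
    exact ((h.eventually (ge_mem_nhds (by positivity))).exists)
  obtain ⟨T, hT⟩ := hT
  refine ⟨T, ?_⟩
  have hlow := (tendsto_atTop_add_const_right atTop (-c) tendsto_id).eventually
    (eventually_le_lintegral_exp_Iic hμ (β := lam⁻¹) (by linarith))
  filter_upwards [hlow] with x hx
  simp only [id, ← sub_eq_add_neg] at hx
  set D := ENNReal.ofReal (lam⁻¹ * Real.exp ((c - x) / lam))
  have hmeas : Measurable fun v : ℝ => ENNReal.ofReal (Real.exp (lam⁻¹ * v)) := by fun_prop
  calc ∫⁻ v in Set.Iio (x - T), affineExpPDF lam c (x - v) ∂μ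
      ≤ ∫⁻ v in Set.Iio (x - T), D * ENNReal.ofReal (Real.exp (lam⁻¹ * v)) ∂μ :=
        lintegral_mono fun v => affineExpPDF_sub_le hlam c x v
    _ = D * ∫⁻ v in Set.Iio (x - T), ENNReal.ofReal (Real.exp (lam⁻¹ * v)) ∂μ :=
        lintegral_const_mul _ hmeas
    _ ≤ D * ENNReal.ofReal (C * Real.exp ((lam⁻¹ - 1) * (x - T))) := by gcongr; exact hup _
    _ ≤ D * (ENNReal.ofReal ε *
          ENNReal.ofReal (Real.exp (-lam⁻¹) * Real.exp ((lam⁻¹ - 1) * (x - c)))) := by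
        gcongr
        rw [← ENNReal.ofReal_mul hε.le]
        refine ENNReal.ofReal_le_ofReal ?_
        have h1 : C * Real.exp ((lam⁻¹ - 1) * (x - T)) =
            C * Real.exp (-((lam⁻¹ - 1) * T)) * Real.exp ((lam⁻¹ - 1) * x) := by
          rw [mul_assoc, ← Real.exp_add]; ring_nf
        have h2 : ε * (Real.exp (-lam⁻¹) * Real.exp ((lam⁻¹ - 1) * (x - c))) =
            ε * Real.exp (-lam⁻¹ - (lam⁻¹ - 1) * c) * Real.exp ((lam⁻¹ - 1) * x) := by
          rw [mul_assoc, ← Real.exp_add, ← Real.exp_add]; ring_nf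
        rw [h1, h2]
        gcongr
    _ ≤ D * (ENNReal.ofReal ε *
          ∫⁻ v in Set.Iic (x - c), ENNReal.ofReal (Real.exp (lam⁻¹ * v)) ∂μ) := by gcongr
    _ = ENNReal.ofReal ε *
          ∫⁻ v in Set.Iic (x - c), D * ENNReal.ofReal (Real.exp (lam⁻¹ * v)) ∂μ := by
        rw [lintegral_const_mul _ hmeas, mul_left_comm]
    _ = ENNReal.ofReal ε * ∫⁻ v in Set.Iic (x - c), affineExpPDF lam c (x - v) ∂μ := by
        congr 1
        exact setLIntegral_congr_fun measurableSet_Iic fun v hv =>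
          (affineExpPDF_sub_of_le hlam hv).symm
    _ ≤ _ := by
        gcongr
        exact setLIntegral_le_lintegral _ _

end Tail

/-! ### Normalising functions over bounded lags -/

/-- If `g' → α` at infinity, then increments of `g` over bounded lags are asymptotically linear. -/
lemma eventually_abs_increment_sub_le {g : ℝ → ℝ} {α : ℝ}
    (hg : ∀ᶠ v in atTop, DifferentiableAt ℝ g v) (hg' : Tendsto (deriv g) atTop (𝓝 α)) (R : ℝ)
    {ε : ℝ} (hε : 0 < ε) :
    ∀ᶠ x in atTop, ∀ v, |x - v| ≤ R → |g x - g v - α * (x - v)| ≤ ε := by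
  have hη : 0 < ε / (|R| + 1) := by positivity
  have hd : ∀ᶠ v in atTop, |deriv g v - α| ≤ ε / (|R| + 1) := by
    filter_upwards [hg'.eventually (Metric.closedBall_mem_nhds α hη)] with v hv
    exact hv
  obtain ⟨M, hM⟩ := eventually_atTop.1 (hg.and hd)
  filter_upwards [eventually_ge_atTop (M + |R|)] with x hx v hv
  have hR := le_abs_self R
  have hxv := abs_le.1 hv
  have hder : ∀ u ∈ Set.Ici M, HasDerivAt (fun u => g u - α * u) (deriv g u - α) u := by
    intro u hu
    have h := (hasDerivAt_id u).const_mul α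
    rw [mul_one] at h
    exact (hM u hu).1.hasDerivAt.sub h
  -- Mean value inequality for `g u - α u`, whose derivative is small on `[M, ∞)`.
  have := Convex.norm_image_sub_le_of_norm_deriv_le (f := fun u => g u - α * u) (s := Set.Ici M)
    (x := v) (y := x) (C := ε / (|R| + 1)) (fun u hu => (hder u hu).differentiableAt)
    (fun u hu => by rw [(hder u hu).deriv]; exact (hM u hu).2) (convex_Ici M)
    (Set.mem_Ici.2 (by linarith)) (Set.mem_Ici.2 (by linarith [abs_nonneg R]))
  rw [Real.norm_eq_abs, Real.norm_eq_abs] at this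
  calc |g x - g v - α * (x - v)| = |g x - α * x - (g v - α * v)| := by ring_nf
    _ ≤ ε / (|R| + 1) * |x - v| := this
    _ ≤ ε / (|R| + 1) * (|R| + 1) := by gcongr; linarith
    _ = ε := by field_simp

/-- The slope of `g` over `[x, 2x]` tends to `2 - 1 = 1`, and by the mean value theorem it is a
value of `g'` at a point beyond `x`. -/
lemma eq_one_of_isEquivalent_id {g : ℝ → ℝ} {α : ℝ}
    (hg : ∀ᶠ v in atTop, DifferentiableAt ℝ g v) (hg' : Tendsto (deriv g) atTop (𝓝 α))
    (hequiv : g ~[atTop] fun x => x) : α = 1 := by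
  have hdiv : Tendsto (fun x => g x / x) atTop (𝓝 1) :=
    (isEquivalent_iff_tendsto_one (eventually_ne_atTop 0)).1 hequiv
  have h2 : Tendsto (fun x : ℝ => 2 * x) atTop atTop := tendsto_id.const_mul_atTop two_pos
  have hslope : Tendsto (fun x => 2 * (g (2 * x) / (2 * x)) - g x / x) atTop (𝓝 (2 * 1 - 1)) :=
    ((hdiv.comp h2).const_mul 2).sub hdiv
  obtain ⟨M, hM⟩ := eventually_atTop.1 hg
  have hex : ∀ᶠ x in atTop, ∃ ξ, x ≤ ξ ∧ deriv g ξ = 2 * (g (2 * x) / (2 * x)) - g x / x := by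
    filter_upwards [eventually_ge_atTop M, eventually_gt_atTop 0] with x hx hx0
    obtain ⟨ξ, hξ, h⟩ := exists_deriv_eq_slope g (show x < 2 * x by linarith)
      (fun u hu => (hM u (hx.trans hu.1)).continuousAt.continuousWithinAt)
      (fun u hu => (hM u (hx.trans hu.1.le)).differentiableWithinAt)
    refine ⟨ξ, hξ.1.le, h.trans ?_⟩
    field_simp
    ring
  have hlim : Tendsto (fun x => 2 * (g (2 * x) / (2 * x)) - g x / x) atTop (𝓝 α) := by
    rw [Metric.tendsto_nhds] at hg' ⊢
    intro ε hε
    obtain ⟨N, hN⟩ := eventually_atTop.1 (hg' ε hε)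
    filter_upwards [hex, eventually_ge_atTop N] with x hx hxN
    obtain ⟨ξ, hξ, h⟩ := hx
    rw [← h]
    exact hN ξ (hxN.trans hξ)
  have := tendsto_nhds_unique hlim hslope
  linarith

/-- Changing the conditioning level by a bounded lag has asymptotically no effect on the normalised
threshold `z`. -/
lemma RegularNormalisation.eventually_abs_threshold_sub_le {a b : ℝ → ℝ} {α : ℝ}
    (hab : RegularNormalisation a b α)
    (hcase : Tendsto b atTop atTop ∨
      (a ~[atTop] fun x => x) ∧ (b ~[atTop] fun _ => (1 : ℝ))) (z R : ℝ) {δ : ℝ} (hδ : 0 < δ) :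
    ∀ᶠ x in atTop, ∀ v, |x - v| ≤ R → |(a x + b x * z - (x - v) - a v) / b v - z| ≤ δ := by
  -- The derivative of `log b` is `b' / b → 0`, so its increments over bounded lags vanish;
  -- exponentiating gives the ratio.
  have hlog : ∀ η > 0, ∀ᶠ x in atTop, ∀ v, |x - v| ≤ R → |b x / b v - 1| ≤ η := by
    intro η hη
    obtain ⟨r, hr, hexp⟩ := Metric.continuousAt_iff.1
      (Real.continuous_exp.continuousAt (x := 0)) η hη
    have hd : ∀ᶠ v in atTop, DifferentiableAt ℝ (fun v => Real.log (b v)) v := by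
      filter_upwards [hab.b_diff] with v hv
      exact hv.log (hab.b_pos v).ne'
    have hd' : Tendsto (deriv fun v => Real.log (b v)) atTop (𝓝 0) := by
      refine hab.b_deriv.congr' ?_
      filter_upwards [hab.b_diff] with v hv
      exact (deriv.log hv (hab.b_pos v).ne').symm
    filter_upwards [eventually_abs_increment_sub_le hd hd' R (half_pos hr)] with x hx v hv
    have h := hx v hv
    rw [zero_mul, sub_zero, ← Real.log_div (hab.b_pos x).ne' (hab.b_pos v).ne'] at h
    have h' := hexp (x := Real.log (b x / b v)) (by
      rw [Real.dist_eq, sub_zero]; linarith)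
    rw [Real.exp_log (div_pos (hab.b_pos x) (hab.b_pos v)), Real.exp_zero, Real.dist_eq] at h'
    exact h'.le
  have hloc : ∀ η > 0, ∀ᶠ x in atTop, ∀ v, |x - v| ≤ R →
      |(a x - a v - (x - v)) / b v| ≤ η := by
    intro η hη
    rcases hcase with hb | ⟨ha, hb⟩
    -- The location error stays below `1 + |α - 1| * |R|`, which a scale tending to infinity
    -- absorbs.
    · have hbig : ∀ᶠ v in atTop, (1 + |α - 1| * |R|) / η ≤ b v := hb.eventually_ge_atTop _
      obtain ⟨M, hM⟩ := eventually_atTop.1 hbig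
      filter_upwards [eventually_abs_increment_sub_le hab.a_diff hab.a_deriv R one_pos,
        eventually_ge_atTop (M + |R|)] with x hx hxM v hv
      have hbv := hM v (by linarith [(abs_le.1 hv).2, le_abs_self R])
      rw [abs_div, abs_of_pos (hab.b_pos v), div_le_iff₀ (hab.b_pos v)]
      rw [div_le_iff₀ hη, mul_comm (b v)] at hbv
      refine le_trans ?_ hbv
      calc |a x - a v - (x - v)| = |(a x - a v - α * (x - v)) + (α - 1) * (x - v)| := by ring_nf
        _ ≤ |a x - a v - α * (x - v)| + |(α - 1) * (x - v)| := abs_add_le _ _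
        _ ≤ 1 + |α - 1| * |R| := by
          rw [abs_mul]
          exact add_le_add (hx v hv)
            (mul_le_mul_of_nonneg_left (hv.trans (le_abs_self R)) (abs_nonneg _))
    -- With `α = 1` the location error is at most `η / 2`, while the scale is eventually at least `1
    -- / 2`.
    · obtain rfl : α = 1 := eq_one_of_isEquivalent_id hab.a_diff hab.a_deriv ha
      have hb1 : Tendsto b atTop (𝓝 1) := (isEquivalent_const_iff_tendsto one_ne_zero).1 hb
      obtain ⟨M, hM⟩ := eventually_atTop.1 (hb1.eventually (le_mem_nhds (one_half_lt_one (α := ℝ))))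
      filter_upwards [eventually_abs_increment_sub_le hab.a_diff hab.a_deriv R (half_pos hη),
        eventually_ge_atTop (M + |R|)] with x hx hxM v hv
      have hbv := hM v (by linarith [(abs_le.1 hv).2, le_abs_self R])
      have h := hx v hv
      rw [one_mul] at h
      rw [abs_div, abs_of_pos (hab.b_pos v), div_le_iff₀ (hab.b_pos v)]
      nlinarith
  have hη : 0 < δ / (|z| + 1) := by positivity
  filter_upwards [hlog _ (half_pos hη), hloc _ (half_pos hδ)] with x h1 h2 v hv
  have hb := (hab.b_pos v).ne'
  calc |(a x + b x * z - (x - v) - a v) / b v - z|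
      = |(b x / b v - 1) * z + (a x - a v - (x - v)) / b v| := by
        congr 1
        field_simp
        ring
    _ ≤ |b x / b v - 1| * |z| + |(a x - a v - (x - v)) / b v| := by
        rw [← abs_mul]; exact abs_add_le _ _
    _ ≤ δ / (|z| + 1) / 2 * (|z| + 1) + δ / 2 := by
        have := h1 v hv
        have := h2 v hv
        gcongr
        linarith
    _ = δ := by field_simp; norm_num

/-! ### Monotonicity and separate continuity -/

/-- For a coordinatewise monotone function, separate continuity bounds the increment along the
diagonal. -/
lemma exists_shift_diag_sub_le {ι : Type*} [Fintype ι] [DecidableEq ι] {G : (ι → ℝ) → ℝ}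
    (hmono : Monotone G) (hcont : ∀ z k, Continuous fun t : ℝ => G (z + t • Pi.single k 1))
    (z : ι → ℝ) {ε : ℝ} (hε : 0 < ε) :
    ∃ δ > 0, G (fun i => z i + δ) ≤ G z + ε ∧ G z - ε ≤ G (fun i => z i - δ) := by
  have hstep : ∀ (w : ι → ℝ) (k : ι) (η : ℝ), 0 < η → ∃ δ : ℝ, 0 < δ ∧
      |G (w + δ • Pi.single k 1) - G w| ≤ η ∧ |G (w + (-δ) • Pi.single k 1) - G w| ≤ η := by
    intro w k η hη
    obtain ⟨r, hr, h⟩ := Metric.continuousAt_iff.1 ((hcont w k).continuousAt (x := 0)) η hη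
    refine ⟨r / 2, by positivity, ?_, ?_⟩
    · have := h (x := r / 2) (by rw [Real.dist_eq, sub_zero, abs_of_pos] <;> linarith)
      simpa [Real.dist_eq] using this.le
    · have := h (x := -(r / 2)) (by rw [Real.dist_eq, sub_zero, abs_neg, abs_of_pos] <;> linarith)
      simpa [Real.dist_eq] using this.le
  -- Induction on the set of moved coordinates, spending half of the error on each new one.
  have hind : ∀ s : Finset ι, ∀ ε > 0, ∃ δ > 0,
      G (fun i => z i + if i ∈ s then δ else 0) ≤ G z + ε ∧
      G z - ε ≤ G (fun i => z i - if i ∈ s then δ else 0) := by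
    intro s
    induction s using Finset.induction_on with
    | empty => exact fun ε hε => ⟨1, one_pos, by simpa using hε.le, by simpa using hε.le⟩
    | insert k s hk ih =>
      intro ε hε
      obtain ⟨δ, hδ, h1, h2⟩ := ih (ε / 2) (half_pos hε)
      obtain ⟨r₁, hr₁, h3, -⟩ := hstep (fun i => z i + if i ∈ s then δ else 0) k _ (half_pos hε)
      obtain ⟨r₂, hr₂, -, h4⟩ := hstep (fun i => z i - if i ∈ s then δ else 0) k _ (half_pos hε)
      -- By monotonicity, reducing all steps to a common smaller one preserves both bounds.
      set ρ := min δ (min r₁ r₂) with hρ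
      have hρ1 : ρ ≤ δ := min_le_left _ _
      have hρ2 : ρ ≤ r₁ := (min_le_right _ _).trans (min_le_left _ _)
      have hρ3 : ρ ≤ r₂ := (min_le_right _ _).trans (min_le_right _ _)
      refine ⟨ρ, lt_min hδ (lt_min hr₁ hr₂), ?_, ?_⟩
      · have hle : (fun i => z i + if i ∈ insert k s then ρ else 0) ≤
            (fun i => z i + if i ∈ s then δ else 0) + r₁ • Pi.single k 1 := by
          intro i
          by_cases hik : i = k
          · subst hik
            simpa [hk] using hρ2
          · by_cases his : i ∈ s <;> simp [hik, his, hρ1]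
        have := hmono hle
        linarith [(abs_le.1 h3).2]
      · have hle : (fun i => z i - if i ∈ s then δ else 0) + (-r₂) • Pi.single k 1 ≤
            (fun i => z i - if i ∈ insert k s then ρ else 0) := by
          intro i
          by_cases hik : i = k
          · subst hik
            simp [hk]
            linarith
          · by_cases his : i ∈ s
            · simp [hik, his]
              linarith
            · simp [hik, his]
        have := hmono hle
        linarith [(abs_le.1 h4).1]
  obtain ⟨δ, hδ, h⟩ := hind Finset.univ ε hε
  exact ⟨δ, hδ, by simpa using h⟩

/-- Existence of partial derivatives everywhere gives separate continuity. -/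
lemma continuous_line_of_hasPartial {d : ℕ} {G : (Fin d → ℝ) → ℝ} {k : Fin d}
    (h : ∀ z, HasPartial k G z) (z : Fin d → ℝ) :
    Continuous fun t : ℝ => G (z + t • Pi.single k 1) := by
  refine continuous_iff_continuousAt.2 fun t => ?_
  have hd : DifferentiableAt ℝ (fun u : ℝ => G (z + t • Pi.single k 1 + u • Pi.single k 1)) 0 :=
    h (z + t • Pi.single k 1)
  have hc : ContinuousAt (fun u : ℝ => G (z + t • Pi.single k 1 + u • Pi.single k 1)) (t - t) := by
    rw [sub_self]; exact hd.continuousAt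
  have := ContinuousAt.comp (f := fun u : ℝ => u - t) (x := t) hc (by fun_prop)
  refine this.congr (Eventually.of_forall fun u => ?_)
  simp only [Function.comp, add_assoc, ← add_smul, add_sub_cancel]

/-! ### Limits outside null sets and conditional distribution functions -/

lemma eventually_essAtTop_iff {μ : Measure ℝ} {p : ℝ → Prop} :
    (∀ᶠ v in essAtTop μ, p v) ↔ ∃ M, ∀ᵐ v ∂μ, M ≤ v → p v := by
  rw [essAtTop, eventually_inf]
  constructor
  · rintro ⟨s, hs, t, ht, h⟩
    obtain ⟨M, hM⟩ := mem_atTop_sets.1 hs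
    exact ⟨M, by filter_upwards [ht] with v hv hMv using h v ⟨hM v hMv, hv⟩⟩
  · rintro ⟨M, hM⟩
    exact ⟨_, Ici_mem_atTop M, _, hM, fun v hv => hv.2 hv.1⟩

/-- Nontriviality of the filter lets monotonicity and the bounds 0 and 1 pass from `F_v` to `G`. -/
lemma neBot_essAtTop {μ : Measure ℝ} (hμ : ∀ M, μ (Set.Ioi M) ≠ 0) : (essAtTop μ).NeBot := by
  refine ⟨fun h => ?_⟩
  have hF : ∀ᶠ v in essAtTop μ, False := by rw [h]; exact eventually_bot
  obtain ⟨M, hM⟩ := eventually_essAtTop_iff.1 hF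
  refine hμ M (measure_mono_null (fun v hv => ?_) (ae_iff.1 hM))
  simpa using le_of_lt hv

section NormCondDF

variable {Ω : Type*} [MeasurableSpace Ω] (P : Measure Ω) [IsProbabilityMeasure P] {d : ℕ}
  (Y : Fin d → Ω → ℝ) (Y₀ : Ω → ℝ) (a b : Fin d → ℝ → ℝ)

lemma normCondDF_nonneg (v : ℝ) (z : Fin d → ℝ) : 0 ≤ normCondDF P Y Y₀ a b v z :=
  measureReal_nonneg

lemma normCondDF_le_one (v : ℝ) (z : Fin d → ℝ) : normCondDF P Y Y₀ a b v z ≤ 1 :=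
  measureReal_le_one

lemma normCondDF_mono (v : ℝ) : Monotone (normCondDF P Y Y₀ a b v) :=
  fun _ _ h => measureReal_mono fun _ hy i => (hy i).trans (h i)

end NormCondDF

lemma measurableSet_normalised_le {ι : Type*} [Countable ι] (a b z : ι → ℝ) :
    MeasurableSet {y : ι → ℝ | ∀ i, (y i - a i) / b i ≤ z i} := by
  rw [Set.ofPred_forall]
  exact MeasurableSet.iInter fun i => measurableSet_le (by fun_prop) measurable_const

/-! ### Transfer of the conditional limit -/

section Mixture

variable {Ω : Type*} [MeasurableSpace Ω] {P : Measure Ω} [IsProbabilityMeasure P]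

/-- A bound for a posterior mean from a bound on a window carrying most of the posterior mass. -/
lemma measureReal_le_of_bayes {ι : Type*} {μ : Measure ℝ} {ν : Measure (ι → ℝ)}
    {K : Kernel ℝ (ι → ℝ)} [IsMarkovKernel K] {lam c x : ℝ}
    (hlam : 0 < lam) (h0 : convDensity μ (affineExpPDF lam c) x ≠ 0)
    (h1 : convDensity μ (affineExpPDF lam c) x ≠ ∞) {B : Set (ι → ℝ)}
    (hB : ν B * convDensity μ (affineExpPDF lam c) x =
      ∫⁻ v, affineExpPDF lam c (x - v) * K v (shift (x - v) ⁻¹' B) ∂μ)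
    {T ε p : ℝ} (hε : 0 ≤ ε) (hp : 0 ≤ p)
    (htail : ∫⁻ v in Set.Iio (x - T), affineExpPDF lam c (x - v) ∂μ ≤
      ENNReal.ofReal ε * convDensity μ (affineExpPDF lam c) x)
    (hwin : ∀ᵐ v ∂μ, x - T ≤ v → v ≤ x - c → (K v).real (shift (x - v) ⁻¹' B) ≤ p) :
    ν.real B ≤ p + ε := by
  set f := affineExpPDF lam c
  set J := convDensity μ f x with hJ
  have hmeas : Measurable fun v => f (x - v) :=
    (measurable_affineExpPDF lam c).comp (by fun_prop)
  have key : ν B * J ≤ ENNReal.ofReal (p + ε) * J := by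
    calc ν B * J = ∫⁻ v, f (x - v) * K v (shift (x - v) ⁻¹' B) ∂μ := hB
      _ = ∫⁻ v in Set.Iio (x - T), f (x - v) * K v (shift (x - v) ⁻¹' B) ∂μ +
          ∫⁻ v in (Set.Iio (x - T))ᶜ, f (x - v) * K v (shift (x - v) ⁻¹' B) ∂μ :=
        (lintegral_add_compl _ measurableSet_Iio).symm
      _ ≤ ENNReal.ofReal ε * J + ENNReal.ofReal p * J := by
        refine add_le_add (le_trans (lintegral_mono fun v => ?_) htail) ?_
        · exact mul_le_of_le_one_right' prob_le_one
        · calc ∫⁻ v in (Set.Iio (x - T))ᶜ, f (x - v) * K v (shift (x - v) ⁻¹' B) ∂μ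
              ≤ ∫⁻ v in (Set.Iio (x - T))ᶜ, ENNReal.ofReal p * f (x - v) ∂μ := by
                refine lintegral_mono_ae ?_
                rw [ae_restrict_iff' measurableSet_Iio.compl]
                filter_upwards [hwin] with v hv hvT
                rcases le_or_gt v (x - c) with hvc | hvc
                · rw [mul_comm]
                  gcongr
                  rw [← ofReal_measureReal]
                  exact ENNReal.ofReal_le_ofReal
                    (hv (not_lt.1 hvT) hvc)
                -- Beyond `x - c` the shift would lie below `c`, where its density vanishes.
                · simp [f, affineExpPDF_of_lt hlam (show x - v < c by linarith)]
            _ ≤ ∫⁻ v, ENNReal.ofReal p * f (x - v) ∂μ := setLIntegral_le_lintegral _ _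
            _ = ENNReal.ofReal p * J := lintegral_const_mul _ hmeas
      _ = ENNReal.ofReal (p + ε) * J := by
        rw [ENNReal.ofReal_add hp hε, ← add_mul, add_comm]
  exact ENNReal.toReal_le_of_le_ofReal (by linarith) ((ENNReal.mul_le_mul_iff_left h0 h1).1 key)

/-- The conditional limit law is invariant under adding an independent exponential variable with a
lighter tail to all components. -/
theorem tendsto_normCondDF_add {d : ℕ} {Y : Fin d → Ω → ℝ} {Y₀ Q : Ω → ℝ} {a b : Fin d → ℝ → ℝ}
    {α : Fin d → ℝ} {G : (Fin d → ℝ) → ℝ} {lam : ℝ} (c : ℝ)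
    (hY : ∀ i, Measurable (Y i)) (hY₀ : Measurable Y₀) (hQ : Measurable Q)
    (hlam : 0 < lam) (hlam' : lam < 1) (hQexp : P.map Q = expMeasure 1)
    (hind : IndepFun Q (fun ω => (Y₀ ω, fun i => Y i ω)) P)
    (hmargin : (fun v : ℝ => P.real {ω | v < Y₀ ω}) ~[atTop] fun v => Real.exp (-v))
    (hab : ∀ i, RegularNormalisation (a i) (b i) (α i))
    (hlimit : ∀ z, Tendsto (fun v => normCondDF P Y Y₀ a b v z) (essAtTop (P.map Y₀)) (𝓝 (G z)))
    (hG : ∀ z k, HasPartial k G z)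
    (hcase : ∀ i, Tendsto (b i) atTop atTop ∨
      (a i ~[atTop] fun x => x) ∧ (b i ~[atTop] fun _ => (1 : ℝ))) (z : Fin d → ℝ) :
    Tendsto (fun x => normCondDF P (fun i ω => Y i ω + (lam * Q ω + c))
      (fun ω => Y₀ ω + (lam * Q ω + c)) a b x z)
      (essAtTop (P.map fun ω => Y₀ ω + (lam * Q ω + c))) (𝓝 (G z)) := by
  have hμprob : IsProbabilityMeasure (P.map Y₀) :=
    Measure.isProbabilityMeasure_map hY₀.aemeasurable
  set μ := P.map Y₀ with hμdef
  have hμ : (fun v : ℝ => μ.real (Set.Ioi v)) ~[atTop] fun v => Real.exp (-v) := by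
    refine hmargin.congr_left (Eventually.of_forall fun v => ?_)
    exact (map_measureReal_apply hY₀ measurableSet_Ioi).symm
  have hpos : ∀ M, μ (Set.Ioi M) ≠ 0 := by
    intro M hM
    have hev := (isEquivalent_iff_tendsto_one
      (Eventually.of_forall fun v : ℝ => (Real.exp_pos (-v)).ne')).1 hμ
    obtain ⟨v, hv, hMv⟩ := ((hev.eventually (lt_mem_nhds one_pos)).and
      (eventually_ge_atTop M)).exists
    have h0 : μ.real (Set.Ioi v) = 0 := by
      rw [measureReal_def, measure_mono_null (Set.Ioi_subset_Ioi hMv) hM, ENNReal.toReal_zero]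
    simp [h0] at hv
  have hne : (essAtTop μ).NeBot := neBot_essAtTop hpos
  have hmono : Monotone G := fun z w h =>
    le_of_tendsto_of_tendsto' (hlimit z) (hlimit w) fun v => normCondDF_mono P Y Y₀ a b v h
  have hG0 : 0 ≤ G z := ge_of_tendsto' (hlimit z) fun v => normCondDF_nonneg P Y Y₀ a b v z
  have hG1 : G z ≤ 1 := le_of_tendsto' (hlimit z) fun v => normCondDF_le_one P Y Y₀ a b v z
  have hE : Measurable fun ω => lam * Q ω + c := by fun_prop
  have hEf : P.map (fun ω => lam * Q ω + c) = volume.withDensity (affineExpPDF lam c) := by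
    rw [← map_affine_expMeasure hlam, ← hQexp, Measure.map_map (by fun_prop) hQ]
    rfl
  have hindE : IndepFun (fun ω => lam * Q ω + c) (fun ω => (Y₀ ω, fun i => Y i ω)) P :=
    hind.comp (φ := fun q => lam * q + c) (ψ := id) (by fun_prop) measurable_id
  have hbayes := condDistrib_add_indep (measurable_pi_lambda _ hY) hY₀ hE
    (measurable_affineExpPDF lam c) hEf hindE
  refine Metric.tendsto_nhds.2 fun ε₀ hε₀ => ?_
  -- Three errors of size `ε`: the increment of `G`, the convergence of `F_v`, and the posterior
  -- mass outside the window.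
  obtain ⟨ε, hε, hε'⟩ : ∃ ε > 0, 3 * ε < ε₀ := ⟨ε₀ / 4, by positivity, by linarith⟩
  obtain ⟨δ, hδ, hGup, hGlow⟩ := exists_shift_diag_sub_le hmono
    (fun z k => continuous_line_of_hasPartial (fun z => hG z k) z) z hε
  obtain ⟨T, hT⟩ := exists_posterior_tail_le hμ hlam hlam' c hε
  obtain ⟨M₁, hM₁⟩ := eventually_essAtTop_iff.1
    ((hlimit fun i => z i + δ).eventually (gt_mem_nhds (lt_add_of_pos_right _ hε)))
  obtain ⟨M₂, hM₂⟩ := eventually_essAtTop_iff.1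
    ((hlimit fun i => z i - δ).eventually (lt_mem_nhds (sub_lt_self _ hε)))
  -- On the window `c ≤ x - v ≤ T`, hence the radius `max |c| |T|`.
  have hthr : ∀ᶠ x in atTop, ∀ i, ∀ v, |x - v| ≤ max |c| |T| →
      |(a i x + b i x * z i - (x - v) - a i v) / b i v - z i| ≤ δ :=
    eventually_all.2 fun i => (hab i).eventually_abs_threshold_sub_le (hcase i) (z i) _ hδ
  obtain ⟨M, hM⟩ := eventually_atTop.1 (hT.and (hthr.and (eventually_ge_atTop (max M₁ M₂ + T))))
  refine eventually_essAtTop_iff.2 ⟨M, ?_⟩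
  filter_upwards [hbayes] with x hx hMx
  obtain ⟨h0, h1, hB⟩ := hx
  obtain ⟨htail, hthrx, hxM⟩ := hM x hMx
  set K := condDistrib (fun ω i => Y i ω) Y₀ P with hK
  set ν := condDistrib (fun ω => shift (lam * Q ω + c) fun i => Y i ω)
    (fun ω => Y₀ ω + (lam * Q ω + c)) P x with hν
  set B : Set (Fin d → ℝ) := {y | ∀ i, (y i - a i x) / b i x ≤ z i} with hBdef
  have hBm : MeasurableSet B := measurableSet_normalised_le _ _ _
  have hwindow : ∀ v, x - T ≤ v → v ≤ x - c → |x - v| ≤ max |c| |T| ∧ M₁ ≤ v ∧ M₂ ≤ v := by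
    intro v hv1 hv2
    have h3 := le_max_left M₁ M₂
    have h4 := le_max_right M₁ M₂
    refine ⟨abs_le.2 ⟨?_, ?_⟩, by linarith, by linarith⟩
    · linarith [neg_abs_le c, le_max_left |c| |T|]
    · linarith [le_abs_self T, le_max_right |c| |T|]
  have hcoord : ∀ v i, ∀ y : Fin d → ℝ,
      (shift (x - v) y i - a i x) / b i x ≤ z i ↔
        (y i - a i v) / b i v ≤ (a i x + b i x * z i - (x - v) - a i v) / b i v := by
    intro v i y
    rw [div_le_iff₀ ((hab i).b_pos x), div_le_div_iff_of_pos_right ((hab i).b_pos v), shift]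
    constructor <;> intro h <;> linarith
  have hupper : ν.real B ≤ G z + 2 * ε + ε := by
    refine measureReal_le_of_bayes (K := K) hlam h0 h1 (hB B hBm) hε.le (by positivity) htail ?_
    filter_upwards [hM₁] with v hv hv1 hv2
    obtain ⟨hR, hMv, -⟩ := hwindow v hv1 hv2
    have hle : (K v).real (shift (x - v) ⁻¹' B) ≤ normCondDF P Y Y₀ a b v (fun i => z i + δ) := by
      refine measureReal_mono fun y hy i => ((hcoord v i y).1 (hy i)).trans ?_
      linarith [(abs_le.1 (hthrx i v hR)).2]
    linarith [hv hMv]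
  -- The lower bound on `B` comes from applying the same upper estimate to its complement.
  have hlower : ν.real Bᶜ ≤ 1 - G z + 2 * ε + ε := by
    refine measureReal_le_of_bayes (K := K) hlam h0 h1 (hB Bᶜ hBm.compl) hε.le (by linarith)
      htail ?_
    filter_upwards [hM₂] with v hv hv1 hv2
    obtain ⟨hR, -, hMv⟩ := hwindow v hv1 hv2
    rw [Set.preimage_compl, probReal_compl_eq_one_sub (measurable_shift _ hBm)]
    have hle : normCondDF P Y Y₀ a b v (fun i => z i - δ) ≤ (K v).real (shift (x - v) ⁻¹' B) := by
      refine measureReal_mono fun y hy i => (hcoord v i y).2 ?_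
      linarith [(abs_le.1 (hthrx i v hR)).1, hy i]
    linarith [hv hMv]
  rw [probReal_compl_eq_one_sub hBm] at hlower
  change |ν.real B - G z| < ε₀
  rw [abs_lt]
  constructor <;> linarith

end Mixture

end HWMixture

end

theorem mainTheorem3 {Ω : Type*} [MeasurableSpace Ω] (P : Measure Ω) [IsProbabilityMeasure P]
    {S : Set HWMixture.Plane} (V : S → Ω → ℝ) (Q : Ω → ℝ) (lam : ℝ)
    (a b : HWMixture.Plane → ℝ → ℝ)
    (hV : ∀ s, Measurable (V s)) (hQ : Measurable Q)
    (hlam : 0 < lam) (hlam' : lam < 1)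
    (hQexp : P.map Q = expMeasure 1)
    (hindep : IndepFun Q (fun ω s => V s ω) P)
    (hmargin : ∀ s, (fun v : ℝ => P.real {ω | v < V s ω}) ~[atTop] fun v => Real.exp (-v))
    (s₀ : S) (d : ℕ) (s : Fin d → S) (α : Fin d → ℝ)
    (hab : ∀ i, HWMixture.RegularNormalisation
      (a ((s i : HWMixture.Plane) - s₀)) (b ((s i : HWMixture.Plane) - s₀)) (α i))
    (G : (Fin d → ℝ) → ℝ)
    (hlimit : ∀ z, Tendsto
      (fun v => HWMixture.normCondDF P (fun i => V (s i)) (V s₀)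
        (fun i => a ((s i : HWMixture.Plane) - s₀)) (fun i => b ((s i : HWMixture.Plane) - s₀)) v z)
      (HWMixture.essAtTop (P.map (V s₀))) (𝓝 (G z)))
    (hpartials : HWMixture.PartialsConverge (HWMixture.essAtTop (P.map (V s₀)))
      (HWMixture.normCondDF P (fun i => V (s i)) (V s₀)
        (fun i => a ((s i : HWMixture.Plane) - s₀)) (fun i => b ((s i : HWMixture.Plane) - s₀))) G)
    (hcase : (∀ i, Tendsto (b ((s i : HWMixture.Plane) - s₀)) atTop atTop) ∨
      (∀ i, (a ((s i : HWMixture.Plane) - s₀) ~[atTop] fun x => x) ∧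
        (b ((s i : HWMixture.Plane) - s₀) ~[atTop] fun _ => (1 : ℝ)))) :
    ∀ z, Tendsto
      (fun x => HWMixture.normCondDF P (fun i => HWMixture.mixture V Q lam (s i))
        (HWMixture.mixture V Q lam s₀)
        (fun i => a ((s i : HWMixture.Plane) - s₀)) (fun i => b ((s i : HWMixture.Plane) - s₀)) x z)
      (HWMixture.essAtTop (P.map (HWMixture.mixture V Q lam s₀))) (𝓝 (G z)) := by
  intro z
  have hind : IndepFun Q (fun ω => (V s₀ ω, fun i => V (s i) ω)) P :=
    hindep.comp (φ := id) (ψ := fun w : S → ℝ => (w s₀, fun i => w (s i))) measurable_id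
      (by fun_prop)
  have hcase' : ∀ i, Tendsto (b ((s i : HWMixture.Plane) - s₀)) atTop atTop ∨
      (a ((s i : HWMixture.Plane) - s₀) ~[atTop] fun x => x) ∧
        (b ((s i : HWMixture.Plane) - s₀) ~[atTop] fun _ => (1 : ℝ)) :=
    fun i => hcase.imp (fun h => h i) fun h => h i
  have hmix : ∀ t, HWMixture.mixture V Q lam t =
      fun ω => V t ω + (lam * Q ω + Real.log (1 - lam)) :=
    fun t => funext fun ω => add_assoc _ _ _
  simp only [hmix]
  exact HWMixture.tendsto_normCondDF_add (Real.log (1 - lam)) (fun i => hV (s i)) (hV s₀) hQ hlam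
    hlam' hQexp hind (hmargin s₀) hab hlimit hpartials.limit_first hcase' z
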